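/- Let $G$ be a finite group of odd order $n$, and put $n^*=(-1)^{(n-1)/2}n$. For an integer $a$ prime to $n$, the map $g\mapsto g^a$ induces a permutation of the set of conjugacy classes of $G$. Let $\left(\frac{a}{G}\right)$ be $1$ if this permutation is even and $-1$ if it is odd, and put $\left(\frac{a}{G}\right)=0$ for integers $a$ with $\gcd(a,n)\neq 1$. Call a conjugacy class $C$ real if $C^{-1}=C$ and complex otherwise, let $C_1,\dots,C_{r_1}$ be the real conjugacy classes and $2r_2$ the number of complex ones, and define the discriminant of $G$ by $$d(G)=(-1)^{r_2}\,|G|^{r_1}\prod_{j=1}^{r_1}|C_j|^{-1}.$$ For a non-zero integer $d\equiv 0,1 \pmod 4$ let $\left(\frac{d}{\cdot}\right)$ be the Kronecker symbol: it extends the Jacobi symbol (whose lower entry is odd and positive) multiplicatively to all non-zero integers, with $\left(\frac{d}{2}\right)=0$, $1$, $-1$ according as $d$ is even, $d\equiv 1\pmod 8$, $d\equiv 5\pmod 8$, and with $\left(\frac{d}{-1}\right)$ the sign of $d$; moreover $\left(\frac{d}{0}\right)=0$ if $d\ne 1$, and $\left(\frac{1}{0}\right)=1$. Then: 1. $d(G)=n^*$;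 2. $\left(\frac{a}{G}\right)=\left(\frac{n^*}{a}\right)$ for every integer $a$; 3. $\left(\frac{\cdot}{G}\right)$ is trivial, that is, $\left(\frac{a}{G}\right)=1$ for every integer $a$ prime to $n$, if and only if $n$ is a square. -/

import Mathlib

/-- The Kronecker symbol `(d / 2)`: it is `0` for even `d`, `1` for `d ≡ ±1 (mod 8)` and `-1` for
`d ≡ ±3 (mod 8)`. An odd discriminant `d ≡ 1 (mod 4)` is `1` or `5` modulo `8`. -/
def kroneckerTwo (d : ℤ) : ℤ :=
  if Even d then 0 else if d % 8 = 1 ∨ d % 8 = 7 then 1 else -1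

/-- The Kronecker symbol `(d / -1)`: the sign of `d`, for `d ≠ 0`. -/
def kroneckerNegOne (d : ℤ) : ℤ :=
  if d < 0 then -1 else 1

/-- The Kronecker symbol `(d / a)`. For `a = ± 2 ^ k * b` with `b` odd and positive, it is
`(d / ±1) * (d / 2) ^ k * (d / b)`, where `(d / b)` is the Jacobi symbol. For `a = 0` it is `1` if
`d = ±1` (among discriminants `d ≡ 0, 1 (mod 4)` this is `d = 1` only) and `0` otherwise. -/
def kroneckerSymbol (d a : ℤ) : ℤ :=
  if a = 0 then (if d = 1 ∨ d = -1 then 1 else 0)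
  else (if a < 0 then kroneckerNegOne d else 1) *
    kroneckerTwo d ^ (a.natAbs.factorization 2) *
    jacobiSym d (a.natAbs / 2 ^ (a.natAbs.factorization 2))

/-- `n* = (-1) ^ ((n - 1) / 2) * n`, meant for odd `n`. -/
def nStar (n : ℕ) : ℤ := (-1) ^ ((n - 1) / 2) * (n : ℤ)

/-- The map on conjugacy classes that sends the class of `g` to the class of `g ^ a`. -/
def conjClassesZPow (G : Type*) [Group G] (a : ℤ) : ConjClasses G → ConjClasses G :=
  Quotient.map (fun g : G => g ^ a) (by
    intro g h hgh
    obtain ⟨c, hc⟩ := isConj_iff.1 (show IsConj g h from hgh)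
    exact isConj_iff.2 ⟨c, by rw [← conj_zpow, hc]⟩)

theorem conjClassesZPow_mk {G : Type*} [Group G] (a : ℤ) (g : G) :
    conjClassesZPow G a (ConjClasses.mk g) = ConjClasses.mk (g ^ a) := rfl

theorem zpow_gcdA_of_coprime {G : Type*} [Group G] {a : ℤ}
    (ha : Int.gcd a (Nat.card G) = 1) (g : G) :
    g ^ (a * Int.gcdA a (Nat.card G)) = g := by
  have h := Int.gcd_eq_gcd_ab a (Nat.card G)
  rw [ha] at h
  have h2 : a * Int.gcdA a (Nat.card G) = 1 - (Nat.card G : ℤ) * Int.gcdB a (Nat.card G) := by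
    push_cast at h; linarith
  rw [h2, zpow_sub, zpow_mul, zpow_natCast, pow_card_eq_one']
  simp

/-- For `a` prime to the order of `G`, the permutation of the conjugacy classes of `G` induced by
`g ↦ g ^ a`. -/
noncomputable def conjClassesPerm (G : Type*) [Group G] (a : ℤ) (ha : Int.gcd a (Nat.card G) = 1) :
    Equiv.Perm (ConjClasses G) where
  toFun := conjClassesZPow G a
  invFun := conjClassesZPow G (Int.gcdA a (Nat.card G))
  left_inv := by
    intro C
    induction C using Quotient.inductionOn with
    | h g =>
      change ConjClasses.mk ((g ^ a) ^ Int.gcdA a (Nat.card G)) = ConjClasses.mk g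
      rw [← zpow_mul, zpow_gcdA_of_coprime ha]
  right_inv := by
    intro C
    induction C using Quotient.inductionOn with
    | h g =>
      change ConjClasses.mk ((g ^ Int.gcdA a (Nat.card G)) ^ a) = ConjClasses.mk g
      rw [← zpow_mul, mul_comm, zpow_gcdA_of_coprime ha]

open Classical in
/-- The quadratic symbol `(a / G)` of a finite group: `0` if `a` is not prime to `|G|`, and
otherwise the sign of the permutation of the conjugacy classes induced by `g ↦ g ^ a`. -/
noncomputable def quadraticSymbol (G : Type*) [Group G] [Finite G] (a : ℤ) : ℤ :=
  letI : Fintype (ConjClasses G) := Fintype.ofFinite _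
  if ha : Int.gcd a (Nat.card G) = 1 then
    ((Equiv.Perm.sign (conjClassesPerm G a ha) : ℤˣ) : ℤ)
  else 0

/-- A conjugacy class `C` is real if its image under `g ↦ g⁻¹` is `C`. -/
def IsRealClass {G : Type*} [Group G] (C : ConjClasses G) : Prop :=
  (fun g : G => g⁻¹) '' C.carrier = C.carrier

/-- The number `r₁` of real conjugacy classes. -/
noncomputable def numRealClasses (G : Type*) [Group G] : ℕ :=
  Nat.card {C : ConjClasses G // IsRealClass C}

/-- Half the number of complex conjugacy classes, `r₂`. Complex classes come in pairs
`C ≠ C⁻¹`, so the division is exact. -/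
noncomputable def numComplexPairs (G : Type*) [Group G] : ℕ :=
  Nat.card {C : ConjClasses G // ¬ IsRealClass C} / 2

/-- The discriminant `d(G) = (-1) ^ r₂ * |G| ^ r₁ * ∏ |C|⁻¹`, the product being over the real
conjugacy classes `C`, as a rational number. -/
noncomputable def groupDiscriminant (G : Type*) [Group G] [Finite G] : ℚ :=
  (-1) ^ numComplexPairs G * (Nat.card G : ℚ) ^ numRealClasses G *
    ∏ᶠ C : {C : ConjClasses G // IsRealClass C}, (Nat.card C.1.carrier : ℚ)⁻¹

/-! The core is a determinant computation with the character table in characteristic `q`, for an odd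
prime `q` not dividing `n`. Over an algebraic closure of `ZMod q` the table `X` is square, and
orthogonality says `X * diag(|C|) * X'ᵀ = n • 1`, where `X'` is `X` with columns permuted by
inversion. With ε = (-1/G), determinants give `ε * (det X)² * ∏ |C| = n ^ h`, `h` being the number
of classes. Frobenius gives χ(g^q) = χ(g)^q, so permuting columns by the `q`-th power map yields
(q/G) det X = (det X)^q, that is, (q/G) = ((det X)²)^((q-1)/2).

Raising the determinant identity to the power (q-1)/2 turns every factor into a Legendre symbol. In
odd order only the trivial class is real, so the other classes cancel in pairs `C`, `C⁻¹` of equal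
size, leaving (q/G) = (εn/q) (`quadraticSymbol_prime_of_isAlgClosed`). Multiplicativity extends this
to odd `b > 0` prime to `n`; periodicity modulo `n` then determines ε, and quadratic reciprocity
gives (a/G) = (a/n) = (n*/a). The discriminant is `(-1) ^ r₂ * n`, and `(-1) ^ r₂` is the sign ε of
inversion. The triviality criterion is a property of (a/n). -/

/-! ### Kronecker and Jacobi symbols -/

theorem nStar_emod_eight {n : ℕ} (hn : Odd n) :
    (n % 8 = 1 ∧ nStar n % 8 = 1) ∨ (n % 8 = 3 ∧ nStar n % 8 = 5) ∨
      (n % 8 = 5 ∧ nStar n % 8 = 5) ∨ (n % 8 = 7 ∧ nStar n % 8 = 1) := by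
  have h2 : n % 2 = 1 := Nat.odd_iff.1 hn
  rcases Nat.even_or_odd ((n - 1) / 2) with h | h
  · have h' := Nat.even_iff.1 h
    rw [nStar, h.neg_one_pow, one_mul]
    omega
  · have h' := Nat.odd_iff.1 h
    rw [nStar, h.neg_one_pow, neg_one_mul]
    omega

theorem kroneckerTwo_nStar {n : ℕ} (hn : Odd n) : kroneckerTwo (nStar n) = jacobiSym 2 n := by
  rw [jacobiSym.at_two hn, ZMod.χ₈_nat_eq_if_mod_eight, kroneckerTwo]
  have h2 : n % 2 = 1 := Nat.odd_iff.1 hn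
  have hE : ¬ Even (nStar n) := by
    rw [Int.even_iff]
    have := nStar_emod_eight hn
    omega
  rw [if_neg hE]
  rcases nStar_emod_eight hn with h | h | h | h <;> simp [h, h2]

theorem kroneckerNegOne_nStar {n : ℕ} (hn : Odd n) :
    kroneckerNegOne (nStar n) = jacobiSym (-1) n := by
  have h2 : n % 2 = 1 := Nat.odd_iff.1 hn
  rw [jacobiSym.at_neg_one hn, ZMod.χ₄_eq_neg_one_pow h2, kroneckerNegOne, nStar]
  have h : (n - 1) / 2 = n / 2 := by omega
  rw [h]
  rcases neg_one_pow_eq_or ℤ (n / 2) with h | h <;> rw [h]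
  · rw [if_neg (by omega)]
  · rw [if_pos (by omega)]

/-- The sign in `n*` cancels the sign of quadratic reciprocity. -/
theorem jacobiSym_nStar {n b : ℕ} (hn : Odd n) (hb : Odd b) :
    jacobiSym (nStar n) b = jacobiSym b n := by
  have h2 : n % 2 = 1 := Nat.odd_iff.1 hn
  have h : (n - 1) / 2 = n / 2 := by omega
  rw [nStar, jacobiSym.mul_left, jacobiSym.quadratic_reciprocity hn hb, jacobiSym.pow_left,
    jacobiSym.at_neg_one hb, ZMod.χ₄_eq_neg_one_pow (Nat.odd_iff.1 hb), h, ← mul_assoc, ← pow_mul,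
    mul_comm (b / 2), ← mul_pow]
  simp

theorem kroneckerSymbol_nStar {n : ℕ} (hn : Odd n) (a : ℤ) :
    kroneckerSymbol (nStar n) a = jacobiSym a n := by
  rw [kroneckerSymbol]
  split_ifs with h0 h1 h2
  · subst h0
    have : n = 1 := by
      have h3 : (nStar n).natAbs = n := by simp [nStar, Int.natAbs_mul, Int.natAbs_pow]
      rcases h1 with h1 | h1 <;> rw [h1] at h3 <;> simpa using h3.symm
    subst this
    simp
  · subst h0
    rw [jacobiSym.zero_left]
    have : n ≠ 1 := by
      rintro rfl
      exact h1 (Or.inl (by simp [nStar]))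
    have := hn.pos
    omega
  all_goals
    have hodd : Odd (a.natAbs / 2 ^ a.natAbs.factorization 2) := by
      have := Nat.not_dvd_ordCompl Nat.prime_two (Int.natAbs_ne_zero.2 h0)
      rw [← Nat.not_even_iff_odd, even_iff_two_dvd]
      exact this
    have habs : (a.natAbs : ℤ) = 2 ^ a.natAbs.factorization 2 *
        ((a.natAbs / 2 ^ a.natAbs.factorization 2 : ℕ) : ℤ) := by
      exact_mod_cast (Nat.ordProj_mul_ordCompl_eq_self a.natAbs 2).symm
    rw [jacobiSym_nStar hn hodd, kroneckerTwo_nStar hn, mul_assoc, ← jacobiSym.pow_left,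
      ← jacobiSym.mul_left, ← habs]
  · rw [kroneckerNegOne_nStar hn, ← jacobiSym.mul_left]
    congr 1
    omega
  · rw [one_mul]
    congr 1
    omega

/-- A non-square positive natural number has a prime factor of odd multiplicity. -/
theorem exists_prime_odd_factorization {n : ℕ} (hn : n ≠ 0) (h : ¬ IsSquare n) :
    ∃ p, p.Prime ∧ Odd (n.factorization p) := by
  by_contra! hc
  refine h ⟨∏ p ∈ n.primeFactors, p ^ (n.factorization p / 2), ?_⟩
  rw [← Finset.prod_mul_distrib]
  conv_lhs => rw [← Nat.prod_factorization_pow_eq_self hn]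
  refine Finset.prod_congr rfl fun p hp => ?_
  have := hc p (Nat.prime_of_mem_primeFactors hp)
  rw [Nat.not_odd_iff_even, Nat.even_iff] at this
  rw [← pow_add]
  congr 1
  omega

theorem forall_jacobiSym_eq_one_iff_isSquare {n : ℕ} (hn : Odd n) :
    (∀ a : ℤ, Int.gcd a n = 1 → jacobiSym a n = 1) ↔ IsSquare n := by
  constructor
  · intro h
    by_contra hsq
    have hn0 : n ≠ 0 := hn.pos.ne'
    obtain ⟨p, hp, hodd⟩ := exists_prime_odd_factorization hn0 hsq
    have : Fact p.Prime := ⟨hp⟩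
    have hpn : p ∣ n := by
      by_contra hc
      rw [Nat.factorization_eq_zero_of_not_dvd hc] at hodd
      exact absurd hodd (by decide)
    have hp2 : p ≠ 2 := by
      rintro rfl
      exact (Nat.not_even_iff_odd.2 hn) (even_iff_two_dvd.2 hpn)
    obtain ⟨u, hu⟩ := FiniteField.exists_nonsquare (F := ZMod p) (by rwa [ZMod.ringChar_zmod_n])
    set m := n / p ^ n.factorization p with hm
    have hcop : Nat.Coprime p m := Nat.coprime_ordCompl hp hn0
    -- A nonresidue modulo `p` that is 1 modulo the prime-to-`p` part of `n`: its Jacobi symbol is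
    -- (-1) to the odd multiplicity of `p`.
    obtain ⟨a, ha1, ha2⟩ := Nat.chineseRemainder hcop u.val 1
    have hJp : jacobiSym a p = -1 := by
      rw [ZMod.nonsquare_iff_jacobiSym_eq_neg_one]
      have : ((a : ℤ) : ZMod p) = u := by
        rw [Int.cast_natCast, (ZMod.natCast_eq_natCast_iff _ _ _).2 ha1, ZMod.natCast_zmod_val]
      rwa [this]
    have hJm : jacobiSym a m = 1 := by
      have : (a : ℤ) % m = 1 % m := by exact_mod_cast ha2
      rw [jacobiSym.mod_left' this, jacobiSym.one_left]
    have hJ : jacobiSym a n = -1 := by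
      conv_lhs => rw [← Nat.ordProj_mul_ordCompl_eq_self n p]
      rw [jacobiSym.mul_right' _ (pow_ne_zero _ hp.ne_zero) (Nat.ordCompl_pos p hn0).ne',
        jacobiSym.pow_right, hJp, ← hm, hJm, hodd.neg_one_pow, mul_one]
    have hg : Int.gcd a n = 1 := by
      by_contra hg
      rw [jacobiSym.eq_zero_iff.2 ⟨hn0, hg⟩] at hJ
      exact absurd hJ (by decide)
    rw [h a hg] at hJ
    exact absurd hJ (by decide)
  · rintro ⟨m, rfl⟩ a ha
    have hm : m ≠ 0 := by
      rintro rfl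
      exact absurd hn (by decide)
    have h1 : Int.gcd a m = 1 := by
      rw [← Nat.dvd_one, ← ha]
      exact Int.gcd_dvd_gcd_of_dvd_right _ (by push_cast; exact dvd_mul_right _ _)
    rw [jacobiSym.mul_right' _ hm hm, ← pow_two, jacobiSym.sq_one h1]

/-! ### Frobenius and traces in characteristic `p` -/

-- After substituting `X ^ p` for `X`, which is injective, both sides are `p`-th powers: `X ^ p - M
-- ^ p = (X - M) ^ p` because `X` commutes with `M`.
open Polynomial in
theorem Matrix.charpoly_pow_char {R n : Type*} [CommRing R] [Fintype n] [DecidableEq n]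
    (p : ℕ) [hp : Fact p.Prime] [CharP R p] (M : Matrix n n R) :
    (M ^ p).charpoly = M.charpoly.map (frobenius R p) := by
  cases (isEmpty_or_nonempty n).symm
  · apply expand_injective hp.out.pos
    have h1 : expand R p (M.charpoly.map (frobenius R p)) = M.charpoly ^ p := by
      rw [← map_expand, map_frobenius_expand]
    rw [h1, Matrix.charpoly, Matrix.charpoly, AlgHom.map_det, ← Matrix.det_pow]
    refine congrArg Matrix.det (matPolyEquiv.injective ?_)
    rw [map_pow, matPolyEquiv_charmatrix, sub_pow_char_of_commute p (C M).commute_X, ← C_pow]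
    exact (id (matPolyEquiv_eq_X_pow_sub_C p M) :)
  · simp [Matrix.charpoly]

theorem Matrix.trace_pow_char {R n : Type*} [CommRing R] [Fintype n] [DecidableEq n]
    (p : ℕ) [hp : Fact p.Prime] [CharP R p] (M : Matrix n n R) :
    (M ^ p).trace = M.trace ^ p := by
  cases (isEmpty_or_nonempty n).symm
  · have : Nontrivial R := CharP.nontrivial_of_char_ne_one hp.out.ne_one
    rw [Matrix.trace_eq_neg_charpoly_coeff, Matrix.trace_eq_neg_charpoly_coeff,
      Matrix.charpoly_pow_char, Polynomial.coeff_map, ← map_neg, frobenius_def]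
  · simp [Matrix.trace, hp.out.ne_zero]

/-! ### Schur orthogonality from a Wedderburn decomposition -/

section
variable {G K : Type*} [Group G] [Field K] {m : ℕ} {d : Fin m → ℕ}

/-- The `i`-th irreducible matrix representation attached to a Wedderburn decomposition of the
group algebra. -/
noncomputable def wedderburnRep (e : MonoidAlgebra K G ≃ₐ[K] Π i, Matrix (Fin (d i)) (Fin (d i)) K)
    (i : Fin m) : G →* Matrix (Fin (d i)) (Fin (d i)) K :=
  ((Pi.evalMonoidHom (fun i => Matrix (Fin (d i)) (Fin (d i)) K) i).comp
    (e : MonoidAlgebra K G →* Π i, Matrix (Fin (d i)) (Fin (d i)) K)).comp (MonoidAlgebra.of K G)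

variable (e : MonoidAlgebra K G ≃ₐ[K] Π i, Matrix (Fin (d i)) (Fin (d i)) K)

theorem wedderburnRep_intertwine {i j : Fin m} {S : Matrix (Fin (d i)) (Fin (d j)) K}
    (hS : ∀ g, wedderburnRep e i g * S = S * wedderburnRep e j g) (f : MonoidAlgebra K G) :
    e f i * S = S * e f j := by
  induction f using MonoidAlgebra.induction_on with
  | of g => exact hS g
  | add f g hf hg => simp only [map_add, Pi.add_apply, Matrix.add_mul, Matrix.mul_add, hf, hg]
  | smul r f hf => simp only [map_smul, Pi.smul_apply, Matrix.smul_mul, Matrix.mul_smul, hf]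

/-- The identity of block `i` acts as 1 on the left of `S` and as 0 on the right. -/
theorem wedderburnRep_intertwine_eq_zero {i j : Fin m} (hij : i ≠ j)
    {S : Matrix (Fin (d i)) (Fin (d j)) K}
    (hS : ∀ g, wedderburnRep e i g * S = S * wedderburnRep e j g) : S = 0 := by
  have := wedderburnRep_intertwine e hS (e.symm (Pi.single i 1))
  simpa [Pi.single_eq_of_ne hij.symm] using this

theorem wedderburnRep_intertwine_eq_scalar {i : Fin m}
    {S : Matrix (Fin (d i)) (Fin (d i)) K}
    (hS : ∀ g, wedderburnRep e i g * S = S * wedderburnRep e i g) :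
    ∃ c : K, S = Matrix.scalar _ c := by
  have h : S ∈ Set.range (Matrix.scalar (Fin (d i))) := by
    rw [Matrix.mem_range_scalar_iff_commute_single']
    intro a b
    have := wedderburnRep_intertwine e hS (e.symm (Pi.single i (Matrix.single a b 1)))
    simpa [Commute, SemiconjBy] using this
  exact h.imp fun c hc => hc.symm

variable [Fintype G]

/-- The intertwiner `∑ g, ρ i g * T * ρ j g⁻¹` obtained from a matrix `T`. -/
noncomputable def wedderburnAverage (i j : Fin m) (T : Matrix (Fin (d i)) (Fin (d j)) K) :
    Matrix (Fin (d i)) (Fin (d j)) K :=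
  ∑ g : G, wedderburnRep e i g * T * wedderburnRep e j g⁻¹

theorem wedderburnRep_mul_average (i j : Fin m) (T : Matrix (Fin (d i)) (Fin (d j)) K) (h : G) :
    wedderburnRep e i h * wedderburnAverage e i j T =
      wedderburnAverage e i j T * wedderburnRep e j h := by
  rw [wedderburnAverage, Matrix.mul_sum, Matrix.sum_mul]
  refine Fintype.sum_equiv (Equiv.mulLeft h) _ _ fun g => ?_
  simp only [Equiv.coe_mulLeft, mul_inv_rev, map_mul, Matrix.mul_assoc]
  rw [← map_mul (wedderburnRep e j) h⁻¹ h]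
  simp

theorem wedderburnRep_trace_mul_trace (i j : Fin m) :
    ∑ g, (wedderburnRep e i g).trace * (wedderburnRep e j g⁻¹).trace =
      ∑ a, ∑ b, wedderburnAverage e i j (Matrix.single a b 1) a b := by
  simp only [wedderburnAverage, Matrix.sum_apply]
  have (a : Fin (d i)) (b : Fin (d j)) (g : G) :
      (wedderburnRep e i g * Matrix.single a b (1 : K) * wedderburnRep e j g⁻¹) a b =
      wedderburnRep e i g a a * wedderburnRep e j g⁻¹ b b := by
    rw [Matrix.mul_apply, Finset.sum_eq_single b]
    · simp
    · intro c _ hc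
      rw [Matrix.mul_single_apply_of_ne _ _ _ _ _ hc, zero_mul]
    · simp
  simp only [this]
  rw [Finset.sum_congr rfl fun a _ => Finset.sum_comm, Finset.sum_comm]
  refine Finset.sum_congr rfl fun g _ => ?_
  simp only [Matrix.trace, Matrix.diag, Finset.sum_mul_sum]

theorem wedderburnRep_orthogonality (hG : (Fintype.card G : K) ≠ 0) [∀ i, NeZero (d i)]
    (i j : Fin m) :
    ∑ g, (wedderburnRep e i g).trace * (wedderburnRep e j g⁻¹).trace =
      if i = j then (Fintype.card G : K) else 0 := by
  rw [wedderburnRep_trace_mul_trace]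
  split_ifs with hij
  · subst hij
    have key (a b : Fin (d i)) :
        wedderburnAverage e i i (Matrix.single a b 1) a b * (d i : K) =
          if a = b then (Fintype.card G : K) else 0 := by
      obtain ⟨c, hc⟩ := wedderburnRep_intertwine_eq_scalar e
        (wedderburnRep_mul_average e i i (Matrix.single a b 1))
      have ht := congrArg Matrix.trace hc
      rw [wedderburnAverage, Matrix.trace_sum] at ht
      have hg (g : G) : (wedderburnRep e i g * Matrix.single a b 1 *
          wedderburnRep e i g⁻¹).trace = (Matrix.single a b (1 : K)).trace := by
        rw [Matrix.trace_mul_comm, ← Matrix.mul_assoc, ← map_mul]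
        simp
      rw [hc]
      simp only [hg, Matrix.scalar_apply, Matrix.trace_diagonal, Finset.sum_const,
        Finset.card_univ, Fintype.card_fin, nsmul_eq_mul] at ht
      rw [Matrix.scalar_apply, Matrix.diagonal_apply]
      split_ifs with hab
      · subst hab
        rw [mul_comm, ← ht]
        simp
      · simp
    -- The degree is invertible in `K` without knowing that it divides `|G|`: otherwise `key` on the
    -- diagonal would force `|G| = 0`.
    have hd : (d i : K) ≠ 0 := by
      intro h0
      have := key 0 0
      rw [h0, mul_zero, if_pos rfl] at this
      exact hG this.symm
    refine mul_right_cancel₀ hd ?_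
    simp only [Finset.sum_mul, key]
    simp [mul_comm]
  · refine Finset.sum_eq_zero fun a _ => Finset.sum_eq_zero fun b _ => ?_
    rw [wedderburnRep_intertwine_eq_zero e hij (wedderburnRep_mul_average e i j _)]
    rfl

end

/-! ### Class functions and the character table -/

theorem Matrix.linearMap_eq_smul_trace {n K : Type*} [Fintype n] [DecidableEq n] [Nonempty n]
    [Field K] (F : Matrix n n K →ₗ[K] K) (hF : ∀ A B, F (A * B) = F (B * A)) :
    ∃ c : K, ∀ A, F A = c * A.trace := by
  obtain ⟨o⟩ := ‹Nonempty n›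
  refine ⟨F (Matrix.single o o 1), fun A => ?_⟩
  have hs (a b : n) (x : K) :
      F (Matrix.single a b x) = if a = b then F (Matrix.single o o 1) * x else 0 := by
    have h := hF (Matrix.single a o x) (Matrix.single o b 1)
    rw [Matrix.single_mul_single_same, mul_one] at h
    rw [h]
    split_ifs with hab
    · subst hab
      rw [Matrix.single_mul_single_same, one_mul, mul_comm, ← smul_eq_mul, ← map_smul,
        Matrix.smul_single, smul_eq_mul, mul_one]
    · rw [Matrix.single_mul_single_of_ne _ _ _ _ (Ne.symm hab), map_zero]
  generalize F (Matrix.single o o 1) = c at hs ⊢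
  conv_lhs => rw [Matrix.matrix_eq_sum_single A]
  simp only [map_sum, hs, Matrix.trace, Matrix.diag, Finset.mul_sum, Finset.sum_ite_eq,
    Finset.mem_univ, if_true]

/-- A class function on `G` is a linear combination of the irreducible characters. -/
theorem exists_classFunction_eq_sum_trace {G K : Type*} [Group G] [Field K] {m : ℕ}
    {d : Fin m → ℕ} [∀ i, NeZero (d i)]
    (e : MonoidAlgebra K G ≃ₐ[K] Π i, Matrix (Fin (d i)) (Fin (d i)) K) (f : ConjClasses G → K) :
    ∃ c : Fin m → K, ∀ g, f (ConjClasses.mk g) = ∑ i, c i * (wedderburnRep e i g).trace := by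
  classical
  -- The linear extension of `f` satisfies `F (x * y) = F (y * x)`, so on each matrix block it is a
  -- multiple of the trace.
  let F : MonoidAlgebra K G →ₗ[K] K :=
    Finsupp.lsum K (fun g => LinearMap.toSpanSingleton K K (f (ConjClasses.mk g))) ∘ₗ
      (MonoidAlgebra.coeffLinearEquiv K).toLinearMap
  have hFof (g : G) : F (MonoidAlgebra.of K G g) = f (ConjClasses.mk g) := by
    simp [F]
  have hF (x y : MonoidAlgebra K G) : F (x * y) = F (y * x) := by
    induction x using MonoidAlgebra.induction_on with
    | of g =>
      induction y using MonoidAlgebra.induction_on with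
      | of h =>
        rw [← map_mul, ← map_mul, hFof, hFof]
        congr 1
        rw [ConjClasses.mk_eq_mk_iff_isConj]
        exact isConj_iff.2 ⟨h, by group⟩
      | add a b ha hb => simp only [mul_add, add_mul, map_add, ha, hb]
      | smul r a ha => simp only [mul_smul_comm, smul_mul_assoc, map_smul, ha]
    | add a b ha hb => simp only [mul_add, add_mul, map_add, ha, hb]
    | smul r a ha => simp only [mul_smul_comm, smul_mul_assoc, map_smul, ha]
  have hc (i : Fin m) : ∃ c : K, ∀ A : Matrix (Fin (d i)) (Fin (d i)) K,
      F (e.symm (Pi.single i A)) = c * A.trace := by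
    refine Matrix.linearMap_eq_smul_trace (F ∘ₗ e.symm.toLinearMap ∘ₗ 
      LinearMap.single K (fun i => Matrix (Fin (d i)) (Fin (d i)) K) i)
      fun A B => ?_
    simp only [LinearMap.comp_apply, LinearMap.coe_single, AlgEquiv.toLinearMap_apply,
      Pi.single_mul, map_mul, hF (e.symm (Pi.single i A))]
  choose c hc using hc
  refine ⟨c, fun g => ?_⟩
  rw [← hFof, ← e.symm_apply_apply (MonoidAlgebra.of K G g),
    ← Finset.univ_sum_single (e (MonoidAlgebra.of K G g))]
  simp only [map_sum, hc]
  rfl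

theorem sum_comp_conjClasses_mk {G M : Type*} [Group G] [Fintype G] [Fintype (ConjClasses G)]
    [CommSemiring M] (F : ConjClasses G → M) :
    ∑ g : G, F (ConjClasses.mk g) = ∑ C, (Nat.card C.carrier : M) * F C := by
  classical
  rw [← Finset.sum_fiberwise (Finset.univ : Finset G) ConjClasses.mk]
  refine Finset.sum_congr rfl fun C _ => ?_
  rw [Finset.sum_congr rfl (g := fun _ => F C)
    (fun g hg => by rw [(Finset.mem_filter.1 hg).2]), Finset.sum_const, nsmul_eq_mul]
  congr 2
  rw [Nat.card_eq_fintype_card, Fintype.card_subtype]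
  congr 1
  ext g
  simp only [Finset.mem_filter_univ, ConjClasses.mem_carrier_iff_mk_eq]

/-- Over an algebraically closed field in which `|G|` is invertible, there is a square character
table satisfying the row orthogonality relations, and compatible with the Frobenius. -/
theorem exists_characterTable (G K : Type*) [Group G] [Finite G] [Fintype (ConjClasses G)]
    [DecidableEq (ConjClasses G)] [Field K] [IsAlgClosed K] (hG : (Nat.card G : K) ≠ 0) :
    ∃ X : Matrix (ConjClasses G) (ConjClasses G) K,
      X * (Matrix.diagonal fun C => (Nat.card C.carrier : K)) *
        (X.submatrix id (conjClassesZPow G (-1))).transpose = (Nat.card G : K) • 1 ∧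
      ∀ (p : ℕ) [Fact p.Prime] [CharP K p] (C D : ConjClasses G),
        X C (conjClassesZPow G p D) = X C D ^ p := by
  classical
  have := Fintype.ofFinite G
  have : NeZero (Nat.card G : K) := ⟨hG⟩
  have : IsSemisimpleRing (MonoidAlgebra K G) := inferInstance
  obtain ⟨m, d, hd, ⟨e⟩⟩ :=
    IsSemisimpleRing.exists_algEquiv_pi_matrix_of_isAlgClosed K (MonoidAlgebra K G)
  have hGf : (Fintype.card G : K) ≠ 0 := by rwa [← Nat.card_eq_fintype_card]
  let X : Matrix (Fin m) (ConjClasses G) K := fun i =>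
    Quotient.lift (fun g => (wedderburnRep e i g).trace) (by
      intro g h hgh
      obtain ⟨c, hc⟩ := isConj_iff.1 (show IsConj g h from hgh)
      rw [← hc, map_mul, map_mul, Matrix.trace_mul_comm, ← Matrix.mul_assoc, ← map_mul]
      simp)
  have hX (i : Fin m) (g : G) : X i (ConjClasses.mk g) = (wedderburnRep e i g).trace := rfl
  let D : Matrix (ConjClasses G) (ConjClasses G) K :=
    Matrix.diagonal fun C => (Nat.card C.carrier : K)
  let X' : Matrix (ConjClasses G) (Fin m) K :=
    (X.submatrix id (conjClassesZPow G (-1))).transpose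
  have horth : X * D * X' = (Nat.card G : K) • (1 : Matrix (Fin m) (Fin m) K) := by
    ext i j
    rw [Matrix.mul_apply, Matrix.smul_apply, Matrix.one_apply, smul_eq_mul, mul_ite, mul_one,
      mul_zero, Nat.card_eq_fintype_card, ← wedderburnRep_orthogonality e hGf i j]
    have h := sum_comp_conjClasses_mk (fun C => X i C * X j (conjClassesZPow G (-1) C))
    simp only [conjClassesZPow_mk, zpow_neg_one, hX] at h
    rw [h]
    refine Finset.sum_congr rfl fun C _ => ?_
    rw [Matrix.mul_diagonal]
    change X i C * _ * X j (conjClassesZPow G (-1) C) = _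
    ring
  -- Expanding class indicators in characters gives a left inverse of `X`; orthogonality gives a
  -- right inverse. Hence `X` is square.
  choose Z hZ using fun C : ConjClasses G =>
    exists_classFunction_eq_sum_trace e (Pi.single C (1 : K))
  have hZX : (Matrix.of Z : Matrix (ConjClasses G) (Fin m) K) * X = 1 := by
    ext C E
    obtain ⟨g, rfl⟩ := E.exists_rep
    rw [Matrix.mul_apply]
    refine (hZ C g).symm.trans ?_
    rw [Pi.single_apply, Matrix.one_apply]
    simp only [eq_comm]
  let Y : Matrix (ConjClasses G) (Fin m) K := (Nat.card G : K)⁻¹ • (D * X')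
  have hXY : X * Y = 1 := by
    rw [Matrix.mul_smul, ← Matrix.mul_assoc, horth, smul_smul, inv_mul_cancel₀ hG, one_smul]
  have hcard : Fintype.card (ConjClasses G) = Fintype.card (Fin m) := by
    refine Matrix.square_of_invertible (Matrix.of Z) X hZX ?_
    have h : Matrix.of Z = Y := by
      rw [← Matrix.mul_one (Matrix.of Z), ← hXY, ← Matrix.mul_assoc, hZX, Matrix.one_mul]
    rw [h, hXY]
  let t := Fintype.equivOfCardEq hcard
  refine ⟨X.submatrix t id, ?_, ?_⟩
  · ext C D
    have h := congrFun (congrFun horth (t C)) (t D)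
    simp only [Matrix.smul_apply, Matrix.one_apply, t.injective.eq_iff] at h ⊢
    rw [← h]
    rfl
  · intro p _ _ C D
    induction D using Quotient.inductionOn with
    | h g =>
      change (wedderburnRep e (t C) (g ^ (p : ℤ))).trace = (wedderburnRep e (t C) g).trace ^ p
      rw [zpow_natCast, map_pow, Matrix.trace_pow_char]

/-! ### Power maps on classes and real classes -/

section
variable {G : Type*} [Group G]

theorem conjClassesZPow_mul (a b : ℤ) (C : ConjClasses G) :
    conjClassesZPow G (a * b) C = conjClassesZPow G a (conjClassesZPow G b C) := by
  induction C using Quotient.inductionOn with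
  | h g =>
    change ConjClasses.mk (g ^ (a * b)) = ConjClasses.mk ((g ^ b) ^ a)
    rw [← zpow_mul, mul_comm]

theorem conjClassesZPow_one (C : ConjClasses G) : conjClassesZPow G 1 C = C := by
  induction C using Quotient.inductionOn with
  | h g =>
    change ConjClasses.mk (g ^ (1 : ℤ)) = ConjClasses.mk g
    rw [zpow_one]

theorem conjClassesZPow_congr {a b : ℤ} (h : a ≡ b [ZMOD Nat.card G]) :
    conjClassesZPow G a = conjClassesZPow G b := by
  funext C
  induction C using Quotient.inductionOn with
  | h g =>
    change ConjClasses.mk (g ^ a) = ConjClasses.mk (g ^ b)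
    obtain ⟨k, hk⟩ := h.dvd
    rw [show b = a + Nat.card G * k by linarith, zpow_add, zpow_mul, zpow_natCast,
      pow_card_eq_one', one_zpow, mul_one]

theorem isRealClass_iff (C : ConjClasses G) : IsRealClass C ↔ conjClassesZPow G (-1) C = C := by
  have h : (fun g : G => g⁻¹) '' C.carrier = (conjClassesZPow G (-1) C).carrier := by
    have hsub (C : ConjClasses G) {g : G} (hg : g ∈ C.carrier) :
        g⁻¹ ∈ (conjClassesZPow G (-1) C).carrier := by
      rw [ConjClasses.mem_carrier_iff_mk_eq] at hg ⊢
      rw [← hg, conjClassesZPow_mk, zpow_neg_one]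
    ext g
    constructor
    · rintro ⟨x, hx, rfl⟩
      exact hsub C hx
    · intro hg
      refine ⟨g⁻¹, ?_, inv_inv g⟩
      have := hsub _ hg
      rwa [← conjClassesZPow_mul, neg_one_mul, neg_neg, conjClassesZPow_one] at this
  rw [IsRealClass, h]
  constructor
  · intro h
    obtain ⟨g, hg⟩ := C.exists_rep
    have hgC : g ∈ (conjClassesZPow G (-1) C).carrier := by
      rw [h]
      exact ConjClasses.mem_carrier_iff_mk_eq.2 hg
    rw [← ConjClasses.mem_carrier_iff_mk_eq.1 hgC]
    exact hg
  · intro h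
    rw [h]

/-- In a group of odd order, the only real conjugacy class is the class of `1`. -/
theorem isRealClass_iff_eq_one [Finite G] (hodd : Odd (Nat.card G)) (C : ConjClasses G) :
    IsRealClass C ↔ C = ConjClasses.mk 1 := by
  rw [isRealClass_iff]
  constructor
  · intro h
    induction C using Quotient.inductionOn with
    | h g =>
      change ConjClasses.mk (g ^ (-1 : ℤ)) = ConjClasses.mk g at h
      rw [ConjClasses.mk_eq_mk_iff_isConj, zpow_neg_one] at h
      obtain ⟨c, hc⟩ := isConj_iff.1 h.symm
      obtain ⟨k, hk⟩ := hodd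
      -- In odd order every `x` is a power of `x ^ 2`. If `c` conjugates `g` to its inverse, `c ^ 2`
      -- commutes with `g`, hence so does `c`; then `g = g⁻¹` and `g = 1`.
      have hpow (x : G) : (x ^ 2) ^ (k + 1) = x := by
        have := pow_card_eq_one' (x := x)
        rw [← pow_mul, show 2 * (k + 1) = Nat.card G + 1 by omega, pow_succ, this, one_mul]
      have hc' : c * g⁻¹ * c⁻¹ = g := by
        have := congrArg Inv.inv hc
        rwa [inv_inv, mul_inv_rev, mul_inv_rev, inv_inv, ← mul_assoc] at this
      have hcomm : Commute (c ^ 2) g := by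
        have : c ^ 2 * g * (c ^ 2)⁻¹ = g := by
          calc c ^ 2 * g * (c ^ 2)⁻¹ = c * (c * g * c⁻¹) * c⁻¹ := by
                simp only [pow_two, mul_inv_rev, mul_assoc]
            _ = g := by rw [hc, hc']
        exact mul_inv_eq_iff_eq_mul.1 this
      have hcg : Commute c g := by
        rw [← hpow c]
        exact hcomm.pow_left _
      have hg : g⁻¹ = g := by
        rw [← hc, hcg.eq, mul_inv_cancel_right]
      have hg2 : g ^ 2 = 1 := by
        rw [pow_two]
        nth_rewrite 1 [← hg]
        exact inv_mul_cancel g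
      have : g = 1 := by rw [← hpow g, hg2, one_pow]
      rw [this]
      rfl
  · rintro rfl
    rw [conjClassesZPow_mk, one_zpow]

theorem card_carrier_conjClassesZPow_neg_one (C : ConjClasses G) :
    Nat.card (conjClassesZPow G (-1) C).carrier = Nat.card C.carrier := by
  refine Nat.card_congr ((Equiv.inv G).subtypeEquiv fun g => ?_)
  change g ∈ _ ↔ g⁻¹ ∈ _
  rw [ConjClasses.mem_carrier_iff_mk_eq, ConjClasses.mem_carrier_iff_mk_eq, ← zpow_neg_one,
    ← conjClassesZPow_mk]
  constructor
  · intro h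
    rw [h, ← conjClassesZPow_mul, neg_one_mul, neg_neg, conjClassesZPow_one]
  · intro h
    rw [← h, ← conjClassesZPow_mul, neg_one_mul, neg_neg, conjClassesZPow_one]

theorem card_carrier_one : Nat.card (ConjClasses.mk (1 : G)).carrier = 1 := by
  have : (ConjClasses.mk (1 : G)).carrier = {1} := by
    ext g
    rw [ConjClasses.mem_carrier_iff_mk_eq, ConjClasses.mk_eq_mk_iff_isConj, isConj_one_left]
    rfl
  rw [this]
  simp

theorem card_carrier_dvd [Finite G] (C : ConjClasses G) : Nat.card C.carrier ∣ Nat.card G := by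
  obtain ⟨g, rfl⟩ := C.exists_rep
  have := Fintype.ofFinite G
  classical
  rw [Nat.card_eq_fintype_card, Nat.card_eq_fintype_card]
  rw [ConjClasses.card_carrier, ← ConjAct.card]
  exact Nat.div_dvd_of_dvd ⟨_, ((MulAction.card_orbit_mul_card_stabilizer_eq_card_group
    (ConjAct G) g).symm.trans (mul_comm _ _))⟩

end

/-! ### The quadratic symbol of a group of odd order -/

theorem int_gcd_congr {a b n : ℤ} (h : a ≡ b [ZMOD n]) : Int.gcd a n = Int.gcd b n := by
  rw [← Int.gcd_emod, h, Int.gcd_emod]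

section
variable {G : Type*} [Group G] [Finite G]

theorem quadraticSymbol_of_gcd_eq_one [Fintype (ConjClasses G)] [DecidableEq (ConjClasses G)]
    {a : ℤ} (ha : Int.gcd a (Nat.card G) = 1) :
    quadraticSymbol G a = (Equiv.Perm.sign (conjClassesPerm G a ha) : ℤ) := by
  rw [quadraticSymbol, dif_pos ha]
  congr!

theorem quadraticSymbol_of_gcd_ne_one {a : ℤ} (ha : Int.gcd a (Nat.card G) ≠ 1) :
    quadraticSymbol G a = 0 := by
  rw [quadraticSymbol, dif_neg ha]

theorem quadraticSymbol_eq_one_or {a : ℤ} (ha : Int.gcd a (Nat.card G) = 1) :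
    quadraticSymbol G a = 1 ∨ quadraticSymbol G a = -1 := by
  classical
  have := Fintype.ofFinite (ConjClasses G)
  rw [quadraticSymbol_of_gcd_eq_one ha]
  rcases Int.units_eq_one_or (Equiv.Perm.sign (conjClassesPerm G a ha)) with h | h <;> simp [h]

theorem quadraticSymbol_mul {a b : ℤ} (ha : Int.gcd a (Nat.card G) = 1)
    (hb : Int.gcd b (Nat.card G) = 1) :
    quadraticSymbol G (a * b) = quadraticSymbol G a * quadraticSymbol G b := by
  classical
  have := Fintype.ofFinite (ConjClasses G)
  have hab : Int.gcd (a * b) (Nat.card G) = 1 :=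
    Int.isCoprime_iff_gcd_eq_one.1
      ((Int.isCoprime_iff_gcd_eq_one.2 ha).mul_left (Int.isCoprime_iff_gcd_eq_one.2 hb))
  rw [quadraticSymbol_of_gcd_eq_one ha, quadraticSymbol_of_gcd_eq_one hb,
    quadraticSymbol_of_gcd_eq_one hab, ← Units.val_mul, ← map_mul]
  congr 2
  ext C
  exact conjClassesZPow_mul a b C

theorem quadraticSymbol_one : quadraticSymbol G 1 = 1 := by
  classical
  have := Fintype.ofFinite (ConjClasses G)
  have h1 : Int.gcd 1 (Nat.card G) = 1 := Int.one_gcd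
  have : conjClassesPerm G 1 h1 = 1 := Equiv.ext fun C => conjClassesZPow_one C
  rw [quadraticSymbol_of_gcd_eq_one h1, this]
  simp

theorem quadraticSymbol_congr {a b : ℤ} (h : a ≡ b [ZMOD Nat.card G]) :
    quadraticSymbol G a = quadraticSymbol G b := by
  classical
  have := Fintype.ofFinite (ConjClasses G)
  have hg : Int.gcd a (Nat.card G) = Int.gcd b (Nat.card G) := int_gcd_congr h
  by_cases ha : Int.gcd a (Nat.card G) = 1
  · have hb := hg ▸ ha
    rw [quadraticSymbol_of_gcd_eq_one ha, quadraticSymbol_of_gcd_eq_one hb]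
    congr 2
    exact Equiv.ext fun C => congrFun (conjClassesZPow_congr h) C
  · rw [quadraticSymbol_of_gcd_ne_one ha, quadraticSymbol_of_gcd_ne_one (hg ▸ ha)]

/-- Euler's criterion, transported to an extension of `ZMod q`. -/
theorem intCast_legendreSym {K : Type*} [Field K] (q : ℕ) [Fact q.Prime] [Algebra (ZMod q) K]
    (a : ℤ) : ((legendreSym q a : ℤ) : K) = (a : K) ^ (q / 2) := by
  have := congrArg (algebraMap (ZMod q) K) (legendreSym.eq_pow q a)
  simpa using this

/-- The product of `f |C|` over all conjugacy classes, for a `±1`-valued `f`, reduces to the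
contribution of the trivial class when `|G|` is odd. -/
theorem prod_conjClasses_eq_of_sq_eq_one [Fintype (ConjClasses G)] (hodd : Odd (Nat.card G))
    {M : Type*} [CommMonoid M] (f : ℕ → M)
    (hf : ∀ C : ConjClasses G, f (Nat.card C.carrier) ^ 2 = 1) :
    ∏ C : ConjClasses G, f (Nat.card C.carrier) = f 1 := by
  classical
  rw [← Finset.mul_prod_erase _ _ (Finset.mem_univ (ConjClasses.mk (1 : G))), card_carrier_one]
  rw [Finset.prod_involution (fun C _ => conjClassesZPow G (-1) C), mul_one]
  · intro C _
    rw [card_carrier_conjClassesZPow_neg_one, ← pow_two, hf]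
  · intro C hC _ h
    rw [← isRealClass_iff, isRealClass_iff_eq_one hodd] at h
    exact (Finset.mem_erase.1 hC).1 h
  · intro C hC
    refine Finset.mem_erase.2 ⟨fun h => (Finset.mem_erase.1 hC).1 ?_, Finset.mem_univ _⟩
    have := congrArg (conjClassesZPow G (-1)) h
    rwa [← conjClassesZPow_mul, neg_one_mul, neg_neg, conjClassesZPow_one, conjClassesZPow_mk,
      one_zpow] at this
  · intro C _
    rw [← conjClassesZPow_mul, neg_one_mul, neg_neg, conjClassesZPow_one]

theorem gcd_neg_one_left (n : ℕ) : Int.gcd (-1) n = 1 := by simp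

theorem quadraticSymbol_prime_of_isAlgClosed (K : Type*) [Field K] [IsAlgClosed K]
    (hodd : Odd (Nat.card G)) (q : ℕ) [hq : Fact q.Prime] [Algebra (ZMod q) K] (hq2 : q ≠ 2)
    (hqG : Int.gcd q (Nat.card G) = 1) :
    quadraticSymbol G q = legendreSym q (quadraticSymbol G (-1) * Nat.card G) := by
  classical
  have := Fintype.ofFinite (ConjClasses G)
  have : CharP K q := charP_of_injective_algebraMap (algebraMap (ZMod q) K).injective q
  have hdvd (c : ℕ) (hc : c ∣ Nat.card G) : (c : ZMod q) ≠ 0 := by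
    rw [Ne, ZMod.natCast_eq_zero_iff]
    intro h
    have h1 : q ∣ Int.gcd q (Nat.card G) := by
      rw [Int.gcd_natCast_natCast]
      exact Nat.dvd_gcd dvd_rfl (h.trans hc)
    rw [hqG] at h1
    exact hq.out.one_lt.ne' (Nat.dvd_one.1 h1)
  have hG : (Nat.card G : K) ≠ 0 := by
    have := (map_ne_zero (algebraMap (ZMod q) K)).2 (hdvd _ dvd_rfl)
    rwa [map_natCast] at this
  obtain ⟨X, hX, hfrob⟩ := exists_characterTable G K hG
  have hm1 := gcd_neg_one_left (Nat.card G)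
  have hdet : X.det * (∏ C : ConjClasses G, (Nat.card C.carrier : K)) *
      ((quadraticSymbol G (-1) : K) * X.det) =
        ∏ _C : ConjClasses G, (Nat.card G : K) := by
    have h := congrArg Matrix.det hX
    rw [Matrix.det_mul, Matrix.det_mul, Matrix.det_diagonal, Matrix.det_transpose,
      Matrix.det_smul, Matrix.det_one, mul_one] at h
    rw [Finset.prod_const, Finset.card_univ, ← h, quadraticSymbol_of_gcd_eq_one hm1]
    congr 1
    exact (Matrix.det_permute' (conjClassesPerm G (-1) hm1) X).symm
  have hdet0 : X.det ≠ 0 := by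
    intro h0
    rw [h0, zero_mul, zero_mul, eq_comm, Finset.prod_eq_zero_iff] at hdet
    obtain ⟨_, _, h⟩ := hdet
    exact hG h
  -- Permuting columns by the `q`-th power map is applying Frobenius entrywise; compare determinants
  -- and cancel one factor `X.det`.
  have hs : (quadraticSymbol G q : K) = (X.det ^ 2) ^ (q / 2) := by
    have h1 : X.submatrix id (conjClassesPerm G q hqG) = (frobenius K q).mapMatrix X := by
      ext C E
      exact hfrob q C E
    have h2 := congrArg Matrix.det h1
    rw [Matrix.det_permute', ← RingHom.map_det, frobenius_def] at h2
    refine mul_right_cancel₀ hdet0 ?_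
    rw [quadraticSymbol_of_gcd_eq_one hqG, h2, ← pow_mul, ← pow_succ]
    congr 1
    have := hq.out.eq_two_or_odd
    omega
  set ε := quadraticSymbol G (-1) with hε
  have hLsq (c : ℕ) (hc : c ∣ Nat.card G) : legendreSym q c ^ 2 = 1 :=
    legendreSym.sq_one q (by simpa using hdvd c hc)
  have hεsq : legendreSym q ε ^ 2 = 1 := by
    refine legendreSym.sq_one q ?_
    rcases quadraticSymbol_eq_one_or hm1 with h | h <;> simp [hε, h]
  have hP := prod_conjClasses_eq_of_sq_eq_one hodd
    (fun c => legendreSym q c * legendreSym q (Nat.card G))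
    (fun C => by rw [mul_pow, hLsq _ (card_carrier_dvd C), hLsq _ dvd_rfl, mul_one])
  rw [Finset.prod_mul_distrib, Nat.cast_one, legendreSym.at_one, one_mul] at hP
  have hPsq : (∏ C : ConjClasses G, legendreSym q (Nat.card C.carrier)) ^ 2 = 1 := by
    rw [← Finset.prod_pow]
    exact Finset.prod_eq_one fun C _ => hLsq _ (card_carrier_dvd C)
  have hpow := congrArg (· ^ (q / 2)) hdet
  rw [show X.det * (∏ C : ConjClasses G, (Nat.card C.carrier : K)) * ((ε : K) * X.det) =
    X.det ^ 2 * (∏ C : ConjClasses G, (Nat.card C.carrier : K)) * (ε : K) by ring, mul_pow,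
    mul_pow, ← hs, ← intCast_legendreSym, ← Finset.prod_pow, ← Finset.prod_pow] at hpow
  have hcast (c : ℕ) : (c : K) ^ (q / 2) = (legendreSym q c : K) := by
    rw [intCast_legendreSym, Int.cast_natCast]
  simp only [hcast] at hpow
  have key : ((quadraticSymbol G q : ℤ) : K) = ((legendreSym q (ε * Nat.card G) : ℤ) : K) := by
    rw [legendreSym.mul]
    have hP' := congrArg (Int.cast : ℤ → K) hP
    have hPsq' := congrArg (Int.cast : ℤ → K) hPsq
    have hεsq' := congrArg (Int.cast : ℤ → K) hεsq
    push_cast at hP' hPsq' hεsq' ⊢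
    generalize ∏ C : ConjClasses G, (legendreSym q (Nat.card C.carrier) : K) = P at *
    generalize ∏ C : ConjClasses G, (legendreSym q (Nat.card G) : K) = N at *
    rw [← hP', ← hpow]
    linear_combination (-(quadraticSymbol G q : K)) * hPsq' * (legendreSym q ε : K) ^ 2 -
      (quadraticSymbol G q : K) * hεsq'
  -- Both symbols are ±1, and `1 ≠ -1` in `K`, so the equality in `K` lifts to ℤ.
  have hchar : ringChar K ≠ 2 := ringChar.eq K q ▸ hq2
  have hne := Ring.neg_one_ne_one_of_char_ne_two hchar
  rcases quadraticSymbol_eq_one_or hqG with h1 | h1 <;>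
    rcases sq_eq_one_iff.1 (show legendreSym q (ε * Nat.card G) ^ 2 = 1 by
      rw [legendreSym.mul, mul_pow, hεsq, hLsq _ dvd_rfl, mul_one]) with h2 | h2 <;>
    rw [h1, h2] at key ⊢ <;> simp at key
  · exact absurd key.symm hne
  · exact absurd key hne

theorem quadraticSymbol_prime (hodd : Odd (Nat.card G)) (q : ℕ) [Fact q.Prime] (hq2 : q ≠ 2)
    (hqG : Int.gcd q (Nat.card G) = 1) :
    quadraticSymbol G q = legendreSym q (quadraticSymbol G (-1) * Nat.card G) :=
  quadraticSymbol_prime_of_isAlgClosed (AlgebraicClosure (ZMod q)) hodd q hq2 hqG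

theorem quadraticSymbol_odd (hodd : Odd (Nat.card G)) (b : ℕ) (hb : Odd b)
    (hbG : Int.gcd b (Nat.card G) = 1) :
    quadraticSymbol G b = jacobiSym (quadraticSymbol G (-1) * Nat.card G) b := by
  induction b using induction_on_primes with
  | zero => exact absurd hb (by decide)
  | one => rw [jacobiSym.one_right, Nat.cast_one, quadraticSymbol_one]
  | prime_mul p a hp ih =>
    have : Fact p.Prime := ⟨hp⟩
    obtain ⟨hp', ha'⟩ := Nat.odd_mul.1 hb
    rw [Int.gcd_natCast_natCast] at hbG
    have hpG : Int.gcd p (Nat.card G) = 1 := Nat.Coprime.coprime_mul_right hbG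
    have haG : Int.gcd a (Nat.card G) = 1 := Nat.Coprime.coprime_mul_left hbG
    rw [Nat.cast_mul, quadraticSymbol_mul hpG haG, ih ha' haG,
      jacobiSym.mul_right' _ hp.ne_zero ha'.pos.ne', ← jacobiSym.legendreSym.to_jacobiSym p,
      quadraticSymbol_prime hodd p (by rintro rfl; exact absurd hp' (by decide)) hpG]

theorem quadraticSymbol_neg_one (hodd : Odd (Nat.card G)) :
    quadraticSymbol G (-1) = (-1) ^ ((Nat.card G - 1) / 2) := by
  set n := Nat.card G with hn
  have h2 := Nat.odd_iff.1 hodd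
  -- `2n + 1` is 1 modulo `n`, so its symbol is 1; it is 3 modulo 4, so the Jacobi symbol (ε/(2n+1))
  -- is ε itself. Reciprocity then gives ε.
  have hb : Odd (2 * n + 1) := ⟨n, rfl⟩
  have hmod : ((2 * n + 1 : ℕ) : ℤ) ≡ 1 [ZMOD n] := by
    rw [Int.modEq_iff_dvd]
    exact ⟨-2, by push_cast; ring⟩
  have hg : Int.gcd ((2 * n + 1 : ℕ) : ℤ) n = 1 := by
    rw [int_gcd_congr hmod, Int.one_gcd]
  have h := quadraticSymbol_odd hodd (2 * n + 1) hb hg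
  rw [quadraticSymbol_congr hmod, quadraticSymbol_one, jacobiSym.mul_left,
    jacobiSym.quadratic_reciprocity hodd hb, jacobiSym.mod_left' hmod, jacobiSym.one_left, mul_one,
    show (2 * n + 1) / 2 = n by omega, mul_comm (n / 2), pow_mul, hodd.neg_one_pow] at h
  rw [show (n - 1) / 2 = n / 2 by omega]
  have hε : jacobiSym (quadraticSymbol G (-1)) (2 * n + 1) = quadraticSymbol G (-1) := by
    rcases quadraticSymbol_eq_one_or (gcd_neg_one_left (Nat.card G)) with h | h <;> rw [h]
    · exact jacobiSym.one_left _
    · rw [jacobiSym.at_neg_one hb, ZMod.χ₄_eq_neg_one_pow (Nat.odd_iff.1 hb),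
        show (2 * n + 1) / 2 = n by omega, hodd.neg_one_pow]
  rw [hε] at h
  rcases neg_one_pow_eq_or ℤ (n / 2) with h' | h' <;> rw [h'] at h ⊢ <;> linarith

theorem quadraticSymbol_eq_jacobiSym (hodd : Odd (Nat.card G)) (a : ℤ) :
    quadraticSymbol G a = jacobiSym a (Nat.card G) := by
  by_cases ha : Int.gcd a (Nat.card G) = 1
  · obtain ⟨b, hb, hab⟩ : ∃ b : ℕ, Odd b ∧ a ≡ b [ZMOD Nat.card G] := by
      have hpos : (0 : ℤ) < Nat.card G := by exact_mod_cast hodd.pos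
      obtain ⟨r, hr⟩ := Int.eq_ofNat_of_zero_le (Int.emod_nonneg a hpos.ne')
      have har : a ≡ r [ZMOD Nat.card G] := by rw [← hr]; exact (Int.mod_modEq _ _).symm
      rcases Nat.even_or_odd r with he | ho
      · refine ⟨r + Nat.card G, he.add_odd hodd, har.trans ?_⟩
        push_cast
        exact Int.ModEq.symm (by simp [Int.ModEq])
      · exact ⟨r, ho, har⟩
    have hbG : Int.gcd b (Nat.card G) = 1 := by rw [← int_gcd_congr hab, ha]
    rw [quadraticSymbol_congr hab, jacobiSym.mod_left' hab, quadraticSymbol_odd hodd b hb hbG,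
      quadraticSymbol_neg_one hodd, ← jacobiSym_nStar hodd hb, nStar]
  · rw [quadraticSymbol_of_gcd_ne_one ha, jacobiSym.eq_zero_iff.2 ⟨hodd.pos.ne', ha⟩]

theorem numRealClasses_eq_one (hodd : Odd (Nat.card G)) : numRealClasses G = 1 := by
  rw [numRealClasses]
  simp only [isRealClass_iff_eq_one hodd]
  simp

/-- Inversion is an involution on classes whose transpositions are the pairs of complex classes. -/
theorem neg_one_pow_numComplexPairs :
    (-1 : ℤ) ^ numComplexPairs G = quadraticSymbol G (-1) := by
  classical
  have := Fintype.ofFinite (ConjClasses G)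
  have hm1 := gcd_neg_one_left (Nat.card G)
  have hsq : conjClassesPerm G (-1) hm1 ^ 2 = 1 := by
    ext C
    change conjClassesZPow G (-1) (conjClassesZPow G (-1) C) = C
    rw [← conjClassesZPow_mul, neg_one_mul, neg_neg, conjClassesZPow_one]
  rw [quadraticSymbol_of_gcd_eq_one hm1, Equiv.Perm.sign_of_pow_two_eq_one hsq, numComplexPairs,
    Nat.card_eq_fintype_card, Fintype.card_subtype_compl]
  push_cast
  congr 3
  rw [← Nat.card_eq_fintype_card, ← Nat.card_eq_fintype_card]
  exact Nat.card_congr (Equiv.subtypeEquivRight isRealClass_iff)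

theorem groupDiscriminant_eq_nStar (hodd : Odd (Nat.card G)) :
    groupDiscriminant G = (nStar (Nat.card G) : ℚ) := by
  have hε := congrArg (Int.cast : ℤ → ℚ)
    ((neg_one_pow_numComplexPairs (G := G)).trans (quadraticSymbol_neg_one hodd))
  push_cast at hε
  rw [groupDiscriminant, numRealClasses_eq_one hodd, hε, nStar, finprod_eq_one_of_forall_eq_one]
  · push_cast
    ring
  · rintro ⟨C, hC⟩
    change (Nat.card C.carrier : ℚ)⁻¹ = 1
    rw [(isRealClass_iff_eq_one hodd C).1 hC, card_carrier_one]
    simp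

end

theorem corollary1 (G : Type*) [Group G] [Finite G] (hodd : Odd (Nat.card G)) :
    groupDiscriminant G = (nStar (Nat.card G) : ℚ) ∧
    (∀ a : ℤ, quadraticSymbol G a = kroneckerSymbol (nStar (Nat.card G)) a) ∧
    ((∀ a : ℤ, Int.gcd a (Nat.card G) = 1 → quadraticSymbol G a = 1) ↔
      IsSquare (Nat.card G)) := by
  refine ⟨groupDiscriminant_eq_nStar hodd, fun a => ?_, ?_⟩
  · rw [quadraticSymbol_eq_jacobiSym hodd, kroneckerSymbol_nStar hodd]
  · simp only [quadraticSymbol_eq_jacobiSym hodd]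
    exact forall_jacobiSym_eq_one_iff_isSquare hodd
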